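/- Let $T$ be a complete first-order theory in a language $L$, let $\kappa>|L|+\aleph_0$ be a cardinal, and let $\mathbb M\models T$ be a $\kappa$-saturated model (for instance a monster model of $T$). For finite tuples $a,b$ and a set $C$ in $\mathbb M$ write $a\mathrel{\perp\!\!\!\perp}^u_C b$ if $\mathrm{tp}(a/C\cup b)$ is finitely satisfiable in $C$, and $a\equiv_C a'$ if $\mathrm{tp}(a/C)=\mathrm{tp}(a'/C)$. An $L$-formula $\varphi(x;y)$ (with $x,y$ finite tuples of variables) exemplifies $\mathrm{SOP}_1$ if there are tuples $(a_\eta)_{\eta\in 2^{<\omega}}$ in $\mathbb M$ such that for every $\eta\in 2^\omega$ the set $\{\varphi(x;a_{\eta|n}):n<\omega\}$ is consistent, and whenever $\eta,\nu\in 2^{<\omega}$ and $\nu$ extends or equals $\eta^\frown 0$, the set $\{\varphi(x;a_{\eta^\frown 1}),\varphi(x;a_\nu)\}$ is inconsistent. If $\varphi(x;y)$ exemplifies $\mathrm{SOP}_1$, then there are an elementary submodel $M\preceq\mathbb M$ with $|M|<\kappa$ and tuples $c_0,c_1,b_0,b_1$ in $\mathbb M$ such that $$c_0\mathrel{\perp\!\!\!\perp}^u_M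 c_1,\qquad c_0\mathrel{\perp\!\!\!\perp}^u_M b_0,\qquad c_1\mathrel{\perp\!\!\!\perp}^u_M b_1,\qquad b_0c_0\equiv_M b_1c_1,\qquad \mathbb M\models\varphi(b_0,c_0)\wedge\varphi(b_1,c_1),$$ but $\varphi(x;c_0)\wedge\varphi(x;c_1)$ is inconsistent. -/

import Mathlib

open scoped FirstOrder

universe u v w x

namespace SOPOne

variable (L : FirstOrder.Language.{u, v}) {N : Type w} [L.Structure N] {ι : Type x}

/-- The type `tp(a/A)` of a tuple `a` of `N` over the parameter set `A`: the set of all formulas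
with parameters from `A` that hold of `a` in `N`. -/
def tp (A : Set N) (a : ι → N) : Set (L[[A]].Formula ι) :=
  {ψ | ψ.Realize a}

/-- `a ≡_A a'`: the tuples `a` and `a'` have the same type over `A`. -/
def SameType (A : Set N) (a a' : ι → N) : Prop :=
  tp L A a = tp L A a'

variable {L}

/-- A set `p` of formulas over `A` is finitely satisfiable in the subset `C` of `N`: each finite
part of `p` is realized in `N` by a tuple all of whose entries lie in `C`. -/
def FinSatIn {A : Set N} (p : Set (L[[A]].Formula ι)) (C : Set N) : Prop :=
  ∀ F : Finset (L[[A]].Formula ι), (F : Set (L[[A]].Formula ι)) ⊆ p →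
    ∃ d : ι → N, (∀ i, d i ∈ C) ∧ ∀ ψ ∈ F, ψ.Realize d

variable (L)

/-- Coheir independence `a ⫝ᵘ_C b` of tuples: `tp(a / C ∪ b)` is finitely satisfiable in `C`. -/
def IndU {κ : Type*} (C : Set N) (a : ι → N) (b : κ → N) : Prop :=
  FinSatIn (tp L (C ∪ Set.range b) a) C

variable (N)

/-- `N` is `κ`-saturated: each set of formulas in one variable over fewer than `κ` parameters
which is finitely satisfiable in `N` is realized in `N`. -/
def IsSaturated (κ : Cardinal.{w}) : Prop :=
  ∀ A : Set N, Cardinal.mk A < κ → ∀ p : Set (L[[A]].Formula Unit),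
    FinSatIn p Set.univ → ∃ a : Unit → N, ∀ ψ ∈ p, ψ.Realize a

variable {N L}

/-- The set `{φ(x; c) : c ∈ A}` of instances of `φ(x; y)` is consistent (with the complete theory
of `N` with names for its elements): each finite part of it is realized in `N`. -/
def ConsistentInstances {m n : ℕ} (φ : L.Formula (Fin m ⊕ Fin n)) (A : Set (Fin n → N)) : Prop :=
  ∀ F : Finset (Fin n → N), (F : Set (Fin n → N)) ⊆ A →
    ∃ b : Fin m → N, ∀ c ∈ F, φ.Realize (Sum.elim b c)

/-- The restriction `η|n` of an infinite binary sequence to its first `n` entries. -/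
def restrict (η : ℕ → Bool) (n : ℕ) : List Bool :=
  List.ofFn fun i : Fin n => η i

variable (N)

/-- `φ(x; y)` exemplifies SOP₁ in `N`. The tree `2^{<ω}` is `List Bool`, `η⌢0` and `η⌢1` are
`η ++ [false]` and `η ++ [true]`, and the tree order is the prefix relation `<+:`. -/
def ExemplifiesSOP1 {m n : ℕ} (φ : L.Formula (Fin m ⊕ Fin n)) : Prop :=
  ∃ a : List Bool → Fin n → N,
    (∀ η : ℕ → Bool, ConsistentInstances φ (Set.range fun k : ℕ => a (restrict η k))) ∧
    ∀ η ν : List Bool, (η ++ [false]) <+: ν →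
      ¬ ConsistentInstances φ {a (η ++ [true]), a ν}

end SOPOne

open FirstOrder Language Cardinal

namespace SOPOne

variable {L : FirstOrder.Language.{u, v}} {N : Type w} [L.Structure N]
-- Types and coheirs in terms of formulas without added constants.
section Types

/-! Descend the tree by always taking `0`. The `1`-siblings passed on the way form a sequence, each
incompatible with all later ones. By pigeonhole two of them agree on any given finite set of
formulas; the later one, `d₀`, joins the branch, and the earlier one, `d₁`, joins the nodes to be
avoided. Since `Comb φ k` is first-order and available for all `k`, saturation upgrades this
agreement to equality of types over a small set (`IsSaturated.exists_comb_extension`).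

Iterating over Skolem hulls (`ExemplifiesSOP1.exists_array`) gives pairs `d₀ i`, `d₁ i` with the
same type over the hull of the earlier pairs, all φ(x; `d₀ i`) jointly consistent, and `d₁ i`
incompatible with `d₀ j` for i < j. Let M be the union of the hulls and let `b₁` realize every φ(x;
`d₀ i`). Along one nonprincipal ultrafilter, `c₁` realizes the limit type of the `d₀ i` over M`b₁`,
and `c₀` that of the `d₁ i` over M`c₁`. Limits of tuples from M are coheirs. A formula over M has
its parameters in one hull, so `c₀` ≡ `c₁` over M, and `b₀` is `b₁` moved along this equivalence.
Incompatibility passes to the limit. -/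

theorem realize_constantsVarsEquiv_coe {ι : Type*} {A : Set N} (ψ : L[[A]].Formula ι)
    (d : ι → N) :
    Formula.Realize (L := L) (BoundedFormula.constantsVarsEquiv ψ : L.Formula (A ⊕ ι))
      (Sum.elim (↑) d) ↔ ψ.Realize d :=
  BoundedFormula.realize_constantsVarsEquiv

theorem sameType_of_forall_formula {ι : Type*} {A : Set N} {a a' : ι → N}
    (h : ∀ ψ : L.Formula (A ⊕ ι),
      ψ.Realize (Sum.elim (↑) a) ↔ ψ.Realize (Sum.elim (↑) a')) : SameType L A a a' := by
  ext ψ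
  have := h (BoundedFormula.constantsVarsEquiv ψ)
  rwa [realize_constantsVarsEquiv_coe, realize_constantsVarsEquiv_coe] at this

theorem indU_of_forall_formula {ι β : Type*} {C : Set N} {a : ι → N} {b : β → N}
    (h : ∀ ψ : L.Formula ((C ⊕ β) ⊕ ι), ψ.Realize (Sum.elim (Sum.elim (↑) b) a) →
      ∃ d : ι → N, (∀ i, d i ∈ C) ∧ ψ.Realize (Sum.elim (Sum.elim (↑) b) d)) :
    IndU L C a b := by
  intro F hF
  have hg : ∀ x : (C ∪ Set.range b : Set N), ∃ y : C ⊕ β, Sum.elim (↑) b y = (x : N) := by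
    rintro ⟨x, hx | ⟨j, rfl⟩⟩
    · exact ⟨Sum.inl ⟨x, hx⟩, rfl⟩
    · exact ⟨Sum.inr j, rfl⟩
  choose g hg using hg
  let χ : L[[(C ∪ Set.range b : Set N)]].Formula ι → L.Formula ((C ⊕ β) ⊕ ι) := fun ψ =>
    Formula.relabel (Sum.map g id) (BoundedFormula.constantsVarsEquiv ψ)
  have hχ : ∀ ψ (d : ι → N), (χ ψ).Realize (Sum.elim (Sum.elim (↑) b) d) ↔ ψ.Realize d := by
    intro ψ d
    rw [← realize_constantsVarsEquiv_coe, Formula.realize_relabel]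
    have : (Sum.elim (Sum.elim (fun c : C => (c : N)) b) d ∘ Sum.map g id) =
        Sum.elim (fun x : (C ∪ Set.range b : Set N) => (x : N)) d := by
      funext z
      rcases z with z | z
      · exact hg z
      · rfl
    rw [this]
  obtain ⟨d, hd, hd'⟩ := h (Formula.iInf fun ψ : F => χ ψ) (by
    rw [Formula.realize_iInf]
    exact fun ψ => (hχ _ _).2 (hF ψ.2))
  rw [Formula.realize_iInf] at hd'
  exact ⟨d, hd, fun ψ hψ => (hχ _ _).1 (hd' ⟨ψ, hψ⟩)⟩

end Types

/-! ### Saturation for finite tuples of variables. -/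

section Saturation

variable {κ : Cardinal.{w}}

theorem IsSaturated.exists_realize_unit (hsat : IsSaturated L N κ) {α : Type w} (v : α → N)
    (hα : #α < κ) {J : Type*} (Γ : J → L.Formula (α ⊕ Unit))
    (h : ∀ s : Finset J, ∃ d : Unit → N, ∀ j ∈ s, (Γ j).Realize (Sum.elim v d)) :
    ∃ d : Unit → N, ∀ j, (Γ j).Realize (Sum.elim v d) := by
  classical
  let χ : J → L[[Set.range v]].Formula Unit := fun j =>
    BoundedFormula.constantsVarsEquiv.symm
      (Formula.relabel (Sum.map (Set.rangeFactorization v) id) (Γ j))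
  have hχ : ∀ j (d : Unit → N), (χ j).Realize d ↔ (Γ j).Realize (Sum.elim v d) := by
    intro j d
    rw [← realize_constantsVarsEquiv_coe]
    simp only [χ, Equiv.apply_symm_apply]
    rw [Formula.realize_relabel]
    have : (Sum.elim (fun x : Set.range v => (x : N)) d ∘
        Sum.map (Set.rangeFactorization v) id) = Sum.elim v d := by
      funext z
      rcases z with z | z <;> rfl
    rw [this]
  obtain ⟨d, hd⟩ := hsat (Set.range v) (mk_range_le.trans_lt hα) (Set.range χ) (by
    intro F hF
    obtain ⟨s, -, rfl⟩ := Finset.subset_set_image_iff.1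
      (show (F : Set _) ⊆ χ '' Set.univ by rwa [Set.image_univ])
    obtain ⟨d, hd⟩ := h s
    refine ⟨d, fun _ => trivial, fun ψ hψ => ?_⟩
    obtain ⟨j, hj, rfl⟩ := Finset.mem_image.1 hψ
    exact (hχ _ _).2 (hd j hj))
  exact ⟨d, fun j => (hχ _ _).1 (hd _ ⟨j, rfl⟩)⟩

theorem IsSaturated.exists_realize_fin (hsat : IsSaturated L N κ) (hκ : ℵ₀ ≤ κ) (k : ℕ) :
    ∀ {α : Type w} (v : α → N), #α < κ → ∀ {J : Type x} (Γ : J → L.Formula (α ⊕ Fin k)),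
    (∀ s : Finset J, ∃ d : Fin k → N, ∀ j ∈ s, (Γ j).Realize (Sum.elim v d)) →
    ∃ d : Fin k → N, ∀ j, (Γ j).Realize (Sum.elim v d) := by
  classical
  induction k with
  | zero =>
    intro α v _ J Γ h
    refine ⟨Fin.elim0, fun j => ?_⟩
    obtain ⟨d, hd⟩ := h {j}
    rw [Subsingleton.elim Fin.elim0 d]
    exact hd j (Finset.mem_singleton_self j)
  | succ k ih =>
    intro α v hα J Γ h
    let g : α ⊕ Fin (k + 1) → (α ⊕ Unit) ⊕ Fin k :=
      Sum.elim (fun a => Sum.inl (Sum.inl a)) (Fin.cases (Sum.inl (Sum.inr ())) Sum.inr)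
    have hg : ∀ (x : Unit → N) (d : Fin k → N),
        Sum.elim (Sum.elim v x) d ∘ g = Sum.elim v (Fin.cons (x ()) d : Fin (k + 1) → N) := by
      intro x d
      funext z
      rcases z with z | z
      · rfl
      · refine Fin.cases ?_ (fun i => ?_) z <;> simp [g]
    -- Indexing by finite sets makes the first coordinate suit every finite conjunction, so the
    -- remaining coordinates still face a finitely satisfiable family.
    let χ : Finset J → L.Formula (α ⊕ Unit) := fun s =>
      Formula.iExs (Fin k) (Formula.relabel g (Formula.iInf fun j : s => Γ j))
    have hχ : ∀ s (x : Unit → N), (χ s).Realize (Sum.elim v x) ↔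
        ∃ d : Fin k → N, ∀ j ∈ s, (Γ j).Realize
          (Sum.elim v (Fin.cons (x ()) d : Fin (k + 1) → N)) := by
      intro s x
      simp only [χ, Formula.realize_iExs, Formula.realize_relabel, Formula.realize_iInf, hg,
        Subtype.forall]
    obtain ⟨x, hx⟩ := hsat.exists_realize_unit v hα χ (by
      intro S
      obtain ⟨d, hd⟩ := h (S.biUnion id)
      refine ⟨fun _ => d 0, fun s hs => (hχ _ _).2 ⟨Fin.tail d, fun j hj => ?_⟩⟩
      rw [Fin.cons_self_tail]
      exact hd j (Finset.mem_biUnion.2 ⟨s, hs, hj⟩))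
    obtain ⟨d, hd⟩ := ih (α := α ⊕ Unit) (Sum.elim v x) (by
        rw [mk_sum, lift_uzero, mk_eq_one Unit, lift_one]
        exact add_lt_of_lt hκ hα (one_lt_aleph0.trans_le hκ))
      (fun j => Formula.relabel g (Γ j)) (by
        intro s
        obtain ⟨d, hd⟩ := (hχ s x).1 (hx s)
        refine ⟨d, fun j hj => ?_⟩
        rw [Formula.realize_relabel, hg]
        exact hd j hj)
    refine ⟨Fin.cons (x ()) d, fun j => ?_⟩
    have := hd j
    rwa [Formula.realize_relabel, hg] at this

/-- In a `κ`-saturated structure, a finitely satisfiable family of formulas in a finite tuple of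
variables over fewer than `κ` parameters is realized. -/
theorem IsSaturated.exists_realize (hsat : IsSaturated L N κ) (hκ : ℵ₀ ≤ κ) {ι : Type*} [Finite ι]
    {α : Type w} (v : α → N) (hα : #α < κ) {J : Type*} (Γ : J → L.Formula (α ⊕ ι))
    (h : ∀ s : Finset J, ∃ d : ι → N, ∀ j ∈ s, (Γ j).Realize (Sum.elim v d)) :
    ∃ d : ι → N, ∀ j, (Γ j).Realize (Sum.elim v d) := by
  obtain ⟨k, ⟨e⟩⟩ := Finite.exists_equiv_fin ι
  have he : ∀ d : Fin k → N, Sum.elim v d ∘ Sum.map id e = Sum.elim v (d ∘ e) := by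
    intro d
    funext z
    rcases z with z | z <;> rfl
  obtain ⟨d, hd⟩ := hsat.exists_realize_fin hκ k v hα
    (fun j => Formula.relabel (Sum.map id e) (Γ j)) (by
      intro s
      obtain ⟨d, hd⟩ := h s
      refine ⟨d ∘ e.symm, fun j hj => ?_⟩
      rw [Formula.realize_relabel, he]
      simpa [Function.comp_assoc] using hd j hj)
  refine ⟨d ∘ e, fun j => ?_⟩
  have := hd j
  rwa [Formula.realize_relabel, he] at this

/-- A complete type which is a limit of types of tuples along an ultrafilter is realized. -/
theorem IsSaturated.exists_realize_of_eventually (hsat : IsSaturated L N κ) (hκ : ℵ₀ ≤ κ)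
    {ι : Type*} [Finite ι] {α : Type w} (v : α → N) (hα : #α < κ) {I : Type*} (U : Ultrafilter I)
    (d : I → ι → N) :
    ∃ c : ι → N, ∀ ψ : L.Formula (α ⊕ ι),
      ψ.Realize (Sum.elim v c) ↔ ∀ᶠ i in U, ψ.Realize (Sum.elim v (d i)) := by
  obtain ⟨c, hc⟩ := hsat.exists_realize hκ v hα
    (fun ψ : {ψ : L.Formula (α ⊕ ι) // ∀ᶠ i in U, ψ.Realize (Sum.elim v (d i))} => ψ.1) (by
      intro s
      obtain ⟨i, hi⟩ := ((Filter.eventually_all_finset s).2 fun j _ => j.2).exists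
      exact ⟨d i, hi⟩)
  refine ⟨c, fun ψ => ⟨fun h => ?_, fun h => hc ⟨ψ, h⟩⟩⟩
  by_contra hn
  rw [← Ultrafilter.eventually_not] at hn
  exact hc ⟨ψ.not, hn⟩ h

end Saturation

/-! ### Finite approximations of the tree and extraction of a pair. -/

section Comb

variable {m n : ℕ} (φ : L.Formula (Fin m ⊕ Fin n))

/-- `φ(x; c)` and `φ(x; c')` are jointly unsatisfiable. -/
def Incompatible (c c' : Fin n → N) : Prop :=
  ¬ ∃ b : Fin m → N, φ.Realize (Sum.elim b c) ∧ φ.Realize (Sum.elim b c')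

/-- `Comb φ k E F` is the first-order approximation of depth `k` to the existence of an SOP₁ tree
whose branches are consistent with the instances at `E` and all of whose nodes are incompatible with
the members of `F`. -/
def Comb : ℕ → List (Fin n → N) → List (Fin n → N) → Prop
  | 0, E, _ => ∃ b : Fin m → N, ∀ e ∈ E, φ.Realize (Sum.elim b e)
  | k + 1, E, F => ∃ y : Fin n → N, (∀ f ∈ F, Incompatible φ f y) ∧
      Comb k (y :: E) F ∧ Comb k E (y :: F)

variable {φ}

theorem consistentInstances_pair {c c' : Fin n → N} :
    ConsistentInstances φ {c, c'} ↔ ¬ Incompatible φ c c' := by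
  classical
  rw [Incompatible, not_not]
  constructor
  · intro h
    obtain ⟨b, hb⟩ := h {c, c'} (by simp)
    exact ⟨b, hb c (by simp), hb c' (by simp)⟩
  · rintro ⟨b, hb, hb'⟩ F hF
    refine ⟨b, fun e he => ?_⟩
    rcases hF he with rfl | rfl
    · exact hb
    · exact hb'

theorem Comb.anti {k : ℕ} {E F E' F' : List (Fin n → N)} (h : Comb φ k E F) (hE : E' ⊆ E)
    (hF : F' ⊆ F) : Comb φ k E' F' := by
  induction k generalizing E F E' F' with
  | zero =>
    obtain ⟨b, hb⟩ := h
    exact ⟨b, fun e he => hb e (hE he)⟩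
  | succ k ih =>
    obtain ⟨y, h1, h2, h3⟩ := h
    exact ⟨y, fun f hf => h1 f (hF hf), ih h2 (List.cons_subset_cons y hE) hF,
      ih h3 hE (List.cons_subset_cons y hF)⟩

/-- Surplus depth is spent on the `0`-side, where only the avoided list grows. -/
theorem Comb.of_add {k j : ℕ} {E F : List (Fin n → N)} (h : Comb φ (k + j) E F) :
    Comb φ k E F := by
  induction j with
  | zero => exact h
  | succ j ih =>
    obtain ⟨y, -, -, h⟩ := h
    exact ih (h.anti (List.Subset.refl _) (List.subset_cons_self y F))

theorem Comb.of_le {k l : ℕ} (hkl : k ≤ l) {E F : List (Fin n → N)} (h : Comb φ l E F) :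
    Comb φ k E F := by
  obtain ⟨j, rfl⟩ := Nat.exists_eq_add_of_le hkl
  exact h.of_add

variable (φ) in
theorem exists_formula_realize_iff_incompatible {α : Type*} (e f : Fin n → α) :
    ∃ ψ : L.Formula α, ∀ v : α → N, ψ.Realize v ↔ Incompatible φ (v ∘ e) (v ∘ f) := by
  refine ⟨(Formula.iExs (Fin m) (φ.relabel (Sum.elim Sum.inr (Sum.inl ∘ e)) ⊓
    φ.relabel (Sum.elim Sum.inr (Sum.inl ∘ f)))).not, fun v => ?_⟩
  have : ∀ (b : Fin m → N) (e : Fin n → α),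
      Sum.elim v b ∘ Sum.elim Sum.inr (Sum.inl ∘ e) = Sum.elim b (v ∘ e) := by
    intro b e
    funext z
    rcases z with z | z <;> rfl
  simp only [Formula.realize_not, Formula.realize_iExs, Formula.realize_inf,
    Formula.realize_relabel, this, Incompatible]

variable (N φ) in
theorem exists_formula_realize_iff_forall_incompatible {α : Type*} (F : List (Fin n → α))
    (e : Fin n → α) :
    ∃ ψ : L.Formula α, ∀ v : α → N, ψ.Realize v ↔
      ∀ f ∈ F.map (v ∘ ·), Incompatible φ f (v ∘ e) := by
  choose ψ hψ using fun f => exists_formula_realize_iff_incompatible (N := N) φ f e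
  have : Finite {f // f ∈ F} := F.finite_toSet
  refine ⟨Formula.iInf fun f : {f // f ∈ F} => ψ f, fun v => ?_⟩
  simp [hψ]

variable (N φ) in
-- Definability of `Comb` is what lets saturation preserve it at all depths simultaneously.
theorem exists_formula_realize_iff_comb (k : ℕ) : ∀ {α : Type x} (E F : List (Fin n → α)),
    ∃ ψ : L.Formula α, ∀ v : α → N, ψ.Realize v ↔
      Comb φ k (E.map (v ∘ ·)) (F.map (v ∘ ·)) := by
  induction k with
  | zero =>
    intro α E F
    have : Finite {e // e ∈ E} := E.finite_toSet
    refine ⟨Formula.iExs (Fin m) (Formula.iInf fun e : {e // e ∈ E} =>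
      φ.relabel (Sum.elim Sum.inr (Sum.inl ∘ e.1))), fun v => ?_⟩
    have : ∀ (b : Fin m → N) (e : Fin n → α),
        Sum.elim v b ∘ Sum.elim Sum.inr (Sum.inl ∘ e) = Sum.elim b (v ∘ e) := by
      intro b e
      funext z
      rcases z with z | z <;> rfl
    simp [Comb, this]
  | succ k ih =>
    intro α E F
    let up : List (Fin n → α) → List (Fin n → α ⊕ Fin n) := List.map (Sum.inl ∘ ·)
    have hup : ∀ (v : α → N) (y : Fin n → N) (F : List (Fin n → α)),
        (up F).map (Sum.elim v y ∘ ·) = F.map (v ∘ ·) := by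
      intro v y F
      simp only [up, List.map_map]
      rfl
    obtain ⟨ψ₁, h₁⟩ := exists_formula_realize_iff_forall_incompatible N φ (up F) Sum.inr
    obtain ⟨ψ₂, h₂⟩ := ih (Sum.inr :: up E) (up F)
    obtain ⟨ψ₃, h₃⟩ := ih (up E) (Sum.inr :: up F)
    refine ⟨Formula.iExs (Fin n) (ψ₁ ⊓ (ψ₂ ⊓ ψ₃)), fun v => ?_⟩
    simp only [Formula.realize_iExs, Formula.realize_inf, h₁, h₂, h₃, List.map_cons, hup,
      Sum.elim_comp_inr, Comb]

theorem restrict_eq_take_append (η : List Bool) (k : ℕ) (hk : k ≤ η.length) :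
    restrict (fun i => η.getD i false) k = η.take k := by
  apply List.ext_getElem
  · simp [restrict, hk]
  · intro i h₁ h₂
    have : i < η.length := by simp [restrict] at h₁; omega
    simp [restrict, this]

theorem comb_of_exemplifiesSOP1_tree {a : List Bool → Fin n → N}
    (h₁ : ∀ η : ℕ → Bool, ConsistentInstances φ (Set.range fun k : ℕ => a (restrict η k)))
    (h₂ : ∀ η ν : List Bool, (η ++ [false]) <+: ν →
      ¬ ConsistentInstances φ {a (η ++ [true]), a ν}) (k : ℕ) :
    ∀ (η : List Bool) (E F : List (Fin n → N)), (∀ e ∈ E, ∃ ζ, ζ <+: η ∧ a ζ = e) →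
      (∀ f ∈ F, ∃ ζ, (ζ ++ [false]) <+: η ∧ a (ζ ++ [true]) = f) → Comb φ k E F := by
  classical
  induction k with
  | zero =>
    intro η E F hE _
    -- Any infinite extension of `η` would do; this one continues with zeros.
    obtain ⟨b, hb⟩ := h₁ (fun i => η.getD i false) E.toFinset (by
      intro e he
      obtain ⟨ζ, hζ, rfl⟩ := hE e (by simpa using he)
      refine ⟨ζ.length, ?_⟩
      simp only
      rw [restrict_eq_take_append _ _ hζ.length_le, ← List.prefix_iff_eq_take.1 hζ])
    exact ⟨b, fun e he => hb e (by simpa using he)⟩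
  | succ k ih =>
    intro η E F hE hF
    -- The `1`-child is the witness: it joins the branch when moving to it, and is avoided by
    -- everything above the `0`-child.
    refine ⟨a (η ++ [true]), fun f hf => ?_, ih (η ++ [true]) _ _ ?_ ?_,
      ih (η ++ [false]) _ _ ?_ ?_⟩
    · obtain ⟨ζ, hζ, rfl⟩ := hF f hf
      have := h₂ ζ (η ++ [true]) (hζ.trans (List.prefix_append _ _))
      rwa [consistentInstances_pair, not_not] at this
    · intro e he
      rcases List.mem_cons.1 he with rfl | he
      · exact ⟨_, List.prefix_refl _, rfl⟩
      · obtain ⟨ζ, hζ, rfl⟩ := hE e he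
        exact ⟨ζ, hζ.trans (List.prefix_append _ _), rfl⟩
    · intro f hf
      obtain ⟨ζ, hζ, rfl⟩ := hF f hf
      exact ⟨ζ, hζ.trans (List.prefix_append _ _), rfl⟩
    · intro e he
      obtain ⟨ζ, hζ, rfl⟩ := hE e he
      exact ⟨ζ, hζ.trans (List.prefix_append _ _), rfl⟩
    · intro f hf
      rcases List.mem_cons.1 hf with rfl | hf
      · exact ⟨_, List.prefix_refl _, rfl⟩
      · obtain ⟨ζ, hζ, rfl⟩ := hF f hf
        exact ⟨ζ, hζ.trans (List.prefix_append _ _), rfl⟩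

theorem ExemplifiesSOP1.comb (h : ExemplifiesSOP1 N φ) (k : ℕ) : Comb (N := N) φ k [] [] := by
  obtain ⟨a, h₁, h₂⟩ := h
  exact comb_of_exemplifiesSOP1_tree h₁ h₂ k [] [] [] (by simp) (by simp)

/-- The terms are the witnesses met by always taking the `0`-side, so each is on the avoided list
when the later ones are chosen. -/
theorem Comb.exists_sequence {k : ℕ} (j : ℕ) {E F : List (Fin n → N)} (h : Comb φ (k + j) E F) :
    ∃ y : Fin j → Fin n → N,
      (∀ i, Comb φ k (y i :: E) F ∧ ∀ f ∈ F, Incompatible φ f (y i)) ∧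
      ∀ i i', i < i' → Comb φ k (y i' :: E) (y i :: F) ∧ Incompatible φ (y i) (y i') := by
  induction j generalizing F with
  | zero => exact ⟨Fin.elim0, fun i => i.elim0, fun i => i.elim0⟩
  | succ j ih =>
    obtain ⟨y, h₁, h₂, h₃⟩ := h
    obtain ⟨z, hz, hz'⟩ := ih h₃
    refine ⟨Fin.cons y z, fun i => ?_, fun i i' => ?_⟩
    · refine Fin.cases ?_ (fun i => ?_) i
      · exact ⟨h₂.of_add, h₁⟩
      · simp only [Fin.cons_succ]
        exact ⟨(hz i).1.anti (List.Subset.refl _) (List.subset_cons_self _ _),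
          fun f hf => (hz i).2 f (List.mem_cons_of_mem _ hf)⟩
    · refine Fin.cases ?_ (fun i' => ?_) i'
      · exact fun h => absurd h (Fin.not_lt_zero i)
      · refine Fin.cases ?_ (fun i => ?_) i
        · intro _
          simp only [Fin.cons_succ, Fin.cons_zero]
          exact ⟨(hz i').1, (hz i').2 y List.mem_cons_self⟩
        · intro hi
          simp only [Fin.cons_succ]
          obtain ⟨h, h'⟩ := hz' i i' (Fin.succ_lt_succ_iff.1 hi)
          exact ⟨h.anti (List.Subset.refl _)
            (List.cons_subset_cons _ (List.subset_cons_self _ _)), h'⟩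

theorem Comb.exists_pair {k : ℕ} {γ : Type*} [Fintype γ] (col : (Fin n → N) → γ)
    {E F : List (Fin n → N)} (h : Comb φ (k + (Fintype.card γ + 1)) E F) :
    ∃ d₀ d₁ : Fin n → N, col d₀ = col d₁ ∧ Comb φ k (d₀ :: E) (d₁ :: F) ∧
      ∀ f ∈ d₁ :: F, Incompatible φ f d₀ := by
  obtain ⟨y, hy, hy'⟩ := h.exists_sequence
  obtain ⟨i, i', hne, hii⟩ := Fintype.exists_ne_map_eq_of_card_lt (fun i => col (y i)) (by simp)
  wlog hlt : i < i' generalizing i i'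
  · exact this i' i hne.symm hii.symm (lt_of_le_of_ne (not_lt.1 hlt) hne.symm)
  obtain ⟨h₁, h₂⟩ := hy' i i' hlt
  -- The later term is `d₀`: the approximation continuing from it still avoids the earlier one.
  refine ⟨y i', y i, hii.symm, h₁, fun f hf => ?_⟩
  rcases List.mem_cons.1 hf with rfl | hf
  · exact h₂
  · exact (hy i').2 f hf

theorem exists_list_map_coe {A : Set N} {E : List (Fin n → N)} (hE : ∀ e ∈ E, ∀ i, e i ∈ A) :
    ∃ E' : List (Fin n → A), E'.map (fun e => ((↑) : A → N) ∘ e) = E := by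
  induction E with
  | nil => exact ⟨[], rfl⟩
  | cons e E ih =>
    obtain ⟨E', rfl⟩ := ih fun e he => hE e (List.mem_cons_of_mem _ he)
    exact ⟨(fun i => ⟨e i, hE e List.mem_cons_self i⟩) :: E', rfl⟩

theorem IsSaturated.exists_comb_extension {κ : Cardinal.{w}} (hsat : IsSaturated L N κ)
    (hκ : ℵ₀ ≤ κ) {A : Set N} (hA : #A < κ) {E F : List (Fin n → N)}
    (hE : ∀ e ∈ E, ∀ i, e i ∈ A) (hF : ∀ f ∈ F, ∀ i, f i ∈ A) (h : ∀ k, Comb φ k E F) :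
    ∃ d₀ d₁ : Fin n → N, (∀ k, Comb φ k (d₀ :: E) (d₁ :: F)) ∧
      (∀ f ∈ d₁ :: F, Incompatible φ f d₀) ∧
      ∀ ψ : L.Formula (A ⊕ Fin n),
        ψ.Realize (Sum.elim (↑) d₀) ↔ ψ.Realize (Sum.elim (↑) d₁) := by
  classical
  obtain ⟨E, rfl⟩ := exists_list_map_coe hE
  obtain ⟨F, rfl⟩ := exists_list_map_coe hF
  clear hE hF
  let up : List (Fin n → A) → List (Fin n → A ⊕ (Fin n ⊕ Fin n)) := List.map (Sum.inl ∘ ·)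
  have hup : ∀ (d : Fin n ⊕ Fin n → N) (F : List (Fin n → A)),
      (up F).map (Sum.elim (↑) d ∘ ·) = F.map (fun e => ((↑) : A → N) ∘ e) := by
    intro d F
    simp only [up, List.map_map]
    rfl
  obtain ⟨ρ, hρ⟩ := exists_formula_realize_iff_forall_incompatible N φ
    ((Sum.inr ∘ Sum.inr) :: up F) (Sum.inr ∘ Sum.inl)
  choose σ hσ using fun k => exists_formula_realize_iff_comb N φ k
    ((Sum.inr ∘ Sum.inl) :: up E) ((Sum.inr ∘ Sum.inr) :: up F)
  let τ : L.Formula (A ⊕ Fin n) → L.Formula (A ⊕ (Fin n ⊕ Fin n)) := fun ψ =>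
    (ψ.relabel (Sum.map id Sum.inl)).iff (ψ.relabel (Sum.map id Sum.inr))
  have hτ : ∀ ψ (d : Fin n ⊕ Fin n → N), (τ ψ).Realize (Sum.elim (↑) d) ↔
      (ψ.Realize (Sum.elim (↑) (d ∘ Sum.inl)) ↔ ψ.Realize (Sum.elim (↑) (d ∘ Sum.inr))) := by
    intro ψ d
    simp only [τ, Formula.realize_iff, Formula.realize_relabel, Sum.elim_comp_map,
      Function.comp_id]
  replace hρ : ∀ d : Fin n ⊕ Fin n → N, ρ.Realize (Sum.elim (↑) d) ↔
      ∀ f ∈ (d ∘ Sum.inr) :: F.map (fun e => ((↑) : A → N) ∘ e),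
        Incompatible φ f (d ∘ Sum.inl) := by
    intro d
    rw [← hup d F]
    exact hρ _
  replace hσ : ∀ k (d : Fin n ⊕ Fin n → N), (σ k).Realize (Sum.elim (↑) d) ↔
      Comb φ k ((d ∘ Sum.inl) :: E.map (fun e => ((↑) : A → N) ∘ e))
        ((d ∘ Sum.inr) :: F.map (fun e => ((↑) : A → N) ∘ e)) := by
    intro k d
    rw [← hup d E, ← hup d F]
    exact hσ k _
  obtain ⟨d, hd⟩ := hsat.exists_realize hκ ((↑) : A → N) hA
    (Sum.elim τ fun k => σ k ⊓ ρ) (by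
      intro s
      -- A finite part involves depths up to `K` and finitely many formulas, whose truth values
      -- serve as the colour.
      let K := s.toRight.sup id
      obtain ⟨d₀, d₁, hc, h₁, h₂⟩ := Comb.exists_pair (k := K)
        (fun d => fun ψ : s.toLeft => decide (ψ.1.Realize (Sum.elim (↑) d))) (h _)
      refine ⟨Sum.elim d₀ d₁, ?_⟩
      rintro (ψ | k) hj
      · have := congrFun hc ⟨ψ, Finset.mem_toLeft.2 hj⟩
        simpa [hτ] using this
      · have hk : k ≤ K := Finset.le_sup (f := id) (Finset.mem_toRight.2 hj)
        simp only [Sum.elim_inr, Formula.realize_inf, hσ, hρ, Sum.elim_comp_inl,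
          Sum.elim_comp_inr]
        exact ⟨h₁.of_le hk, h₂⟩)
  refine ⟨d ∘ Sum.inl, d ∘ Sum.inr, fun k => ?_, ?_, fun ψ => (hτ ψ d).1 (hd (Sum.inl ψ))⟩
  · have := hd (Sum.inr k)
    simp only [Sum.elim_inr, Formula.realize_inf, hσ] at this
    exact this.1
  · have := hd (Sum.inr 0)
    simp only [Sum.elim_inr, Formula.realize_inf, hρ] at this
    exact this.2

end Comb

/-! ### Skolem hulls, homogeneity and the infinite array. -/

section Main

variable {m n : ℕ} {φ : L.Formula (Fin m ⊕ Fin n)} {κ : Cardinal.{w}}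

theorem aleph0_lt_of_lift_max_lt
    (hκ : Cardinal.lift.{w} (max ℵ₀ L.card) < Cardinal.lift.{max u v} κ) : ℵ₀ < κ := by
  rw [lift_max, lift_aleph0] at hκ
  exact aleph0_lt_lift.1 ((le_max_left _ _).trans_lt hκ)

theorem mk_skolem_closure_lt [Nonempty N]
    (hκ : Cardinal.lift.{w} (max ℵ₀ L.card) < Cardinal.lift.{max u v} κ) {s : Set N}
    (hs : s.Countable) : #(Substructure.closure (L.sum L.skolem₁) s) < κ := by
  rw [← lift_lt.{w, max u v}]
  refine Substructure.lift_card_closure_le.trans_lt (lt_of_le_of_lt ?_ hκ)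
  have h₁ : Cardinal.lift.{max u v, w} #s ≤ Cardinal.lift.{w} (max ℵ₀ L.card) := by
    rw [lift_max, lift_aleph0]
    exact (lift_le_aleph0.2 (le_aleph0_iff_set_countable.2 hs)).trans (le_max_left _ _)
  have h₂ := lift_le.{w}.2 (card_functions_sum_skolem₁_le (L := L))
  have h₃ : ℵ₀ ≤ Cardinal.lift.{w} (max ℵ₀ L.card) := by
    rw [lift_max, lift_aleph0]
    exact le_max_left _ _
  exact max_le h₃ (add_le_of_le h₃ h₁ h₂)

theorem mk_sum_fin_lt (hκ : ℵ₀ ≤ κ) {α : Type w} (hα : #α < κ) (k : ℕ) : #(α ⊕ Fin k) < κ := by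
  rw [mk_sum, lift_uzero, mk_fin, lift_natCast]
  exact add_lt_of_lt hκ hα (natCast_lt_aleph0.trans_le hκ)

theorem exists_formula_over_of_iUnion {ι : Type*} {S : ℕ → Set N} (hS : Monotone S) {M : Set N}
    (hM : ∀ x ∈ M, ∃ i, x ∈ S i) (ψ : L.Formula (M ⊕ ι)) :
    ∃ i₀, ∀ i, i₀ ≤ i → ∃ ψ' : L.Formula (S i ⊕ ι), ∀ d : ι → N,
      ψ'.Realize (Sum.elim (↑) d) ↔ ψ.Realize (Sum.elim (↑) d) := by
  classical
  choose g hg using hM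
  let r : M ⊕ ι → ℕ := Sum.elim (fun x => g x x.2) fun _ => 0
  refine ⟨ψ.freeVarFinset.sup r, fun i hi => ?_⟩
  have hf : ∀ z : ψ.freeVarFinset, ∃ y : S i ⊕ ι, ∀ d : ι → N,
      Sum.elim (fun x : S i => (x : N)) d y = Sum.elim (fun x : M => (x : N)) d z := by
    rintro ⟨x | j, hx⟩
    · exact ⟨Sum.inl ⟨x, hS ((Finset.le_sup (f := r) hx).trans hi) (hg x x.2)⟩, fun _ => rfl⟩
    · exact ⟨Sum.inr j, fun _ => rfl⟩
  choose f hf using hf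
  exact ⟨BoundedFormula.restrictFreeVar ψ f, fun d =>
    BoundedFormula.realize_restrictFreeVar _ fun z => hf z d⟩

/-- Finite parts of the type of `b'` over `c'` transfer to `c` by quantifying out `b'`. -/
theorem IsSaturated.exists_realize_of_forall_iff (hsat : IsSaturated L N κ) (hκ : ℵ₀ ≤ κ)
    {α : Type w} (v : α → N) (hα : #α < κ) {k l : ℕ} {c c' : Fin l → N} (b' : Fin k → N)
    (h : ∀ ψ : L.Formula (α ⊕ Fin l), ψ.Realize (Sum.elim v c) ↔ ψ.Realize (Sum.elim v c')) :
    ∃ b : Fin k → N, ∀ ψ : L.Formula ((α ⊕ Fin k) ⊕ Fin l),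
      ψ.Realize (Sum.elim (Sum.elim v b) c) ↔ ψ.Realize (Sum.elim (Sum.elim v b') c') := by
  let g : (α ⊕ Fin k) ⊕ Fin l → (α ⊕ Fin l) ⊕ Fin k :=
    Sum.elim (Sum.elim (Sum.inl ∘ Sum.inl) Sum.inr) (Sum.inl ∘ Sum.inr)
  have hg : ∀ (b : Fin k → N) (c : Fin l → N),
      Sum.elim (Sum.elim v c) b ∘ g = Sum.elim (Sum.elim v b) c := by
    intro b c
    funext z
    rcases z with (z | z) | z <;> rfl
  obtain ⟨b, hb⟩ := hsat.exists_realize hκ (Sum.elim v c) (mk_sum_fin_lt hκ hα l)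
    (fun ψ : {ψ : L.Formula ((α ⊕ Fin k) ⊕ Fin l) //
      ψ.Realize (Sum.elim (Sum.elim v b') c')} => ψ.1.relabel g) (by
      intro s
      have := (h (Formula.iExs (Fin k) (Formula.iInf fun ψ : s => ψ.1.1.relabel g))).2
      simp only [Formula.realize_iExs, Formula.realize_iInf, Formula.realize_relabel, hg] at this
      obtain ⟨b, hb⟩ := this ⟨b', fun ψ => ψ.1.2⟩
      refine ⟨b, fun ψ hψ => ?_⟩
      rw [Formula.realize_relabel, hg]
      exact hb ⟨ψ, hψ⟩)
  simp only [Formula.realize_relabel, hg] at hb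
  refine ⟨b, fun ψ => ⟨fun hψ => ?_, fun hψ => hb ⟨ψ, hψ⟩⟩⟩
  by_contra hn
  exact hb ⟨ψ.not, hn⟩ hψ

/-- The array of pairs extracted from an SOP₁ tree, together with an increasing chain of Skolem
hulls such that the two entries of a pair have the same type over the hull of its predecessors. -/
theorem ExemplifiesSOP1.exists_array [Nonempty N]
    (hκ : Cardinal.lift.{w} (max ℵ₀ L.card) < Cardinal.lift.{max u v} κ)
    (hsat : IsSaturated L N κ) (hφ : ExemplifiesSOP1 N φ) :
    ∃ (d₀ d₁ : ℕ → Fin n → N) (S : ℕ → (L.sum L.skolem₁).Substructure N),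
      Monotone S ∧ #(⨆ i, S i : (L.sum L.skolem₁).Substructure N) < κ ∧
      (∀ i k, d₀ i k ∈ S (i + 1)) ∧ (∀ i k, d₁ i k ∈ S (i + 1)) ∧
      (∀ i, ∃ b : Fin m → N, ∀ j < i, φ.Realize (Sum.elim b (d₀ j))) ∧
      (∀ i j, i < j → Incompatible φ (d₁ i) (d₀ j)) ∧
      ∀ i (ψ : L.Formula (S i ⊕ Fin n)),
        ψ.Realize (Sum.elim (↑) (d₀ i)) ↔ ψ.Realize (Sum.elim (↑) (d₁ i)) := by
  have hκ₀ := aleph0_lt_of_lift_max_lt hκ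
  let State := {p : List (Fin n → N) × List (Fin n → N) // ∀ k, Comb φ k p.1 p.2}
  let entries : State → Set N := fun p => ⋃ e ∈ {e | e ∈ p.1.1 ∨ e ∈ p.1.2}, Set.range e
  have hmem : ∀ (p : State) e, e ∈ p.1.1 ∨ e ∈ p.1.2 → ∀ i, e i ∈ entries p :=
    fun p e he i => Set.mem_biUnion he ⟨i, rfl⟩
  let S : State → (L.sum L.skolem₁).Substructure N := fun p => Substructure.closure _ (entries p)
  have hsub : ∀ p, entries p ⊆ S p := fun p => Substructure.subset_closure
  have hcount : ∀ p, (entries p).Countable := fun p =>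
    Set.Countable.biUnion (((p.1.1.finite_toSet).union (p.1.2.finite_toSet)).countable)
      fun e _ => Set.countable_range e
  have hstep : ∀ p : State, ∃ d₀ d₁ : Fin n → N,
      (∀ k, Comb φ k (d₀ :: p.1.1) (d₁ :: p.1.2)) ∧
      (∀ f ∈ d₁ :: p.1.2, Incompatible φ f d₀) ∧ ∀ ψ : L.Formula (S p ⊕ Fin n),
        ψ.Realize (Sum.elim (↑) d₀) ↔ ψ.Realize (Sum.elim (↑) d₁) := fun p =>
    hsat.exists_comb_extension hκ₀.le (A := S p) (mk_skolem_closure_lt hκ (hcount p))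
      (fun e he i => hsub p (hmem p e (Or.inl he) i))
      (fun e he i => hsub p (hmem p e (Or.inr he) i)) p.2
  choose d₀ d₁ hcomb hinc htype using hstep
  let s : ℕ → State := fun i =>
    Nat.rec ⟨([], []), fun k => hφ.comb k⟩ (fun _ p => ⟨(d₀ p :: p.1.1, d₁ p :: p.1.2), hcomb p⟩) i
  have hmono : ∀ i j, i ≤ j → (s i).1.1 ⊆ (s j).1.1 ∧ (s i).1.2 ⊆ (s j).1.2 := by
    intro i j hij
    induction j, hij using Nat.le_induction with
    | base => exact ⟨List.Subset.refl _, List.Subset.refl _⟩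
    | succ j _ ih =>
      exact ⟨List.Subset.trans ih.1 (List.subset_cons_self _ _),
        List.Subset.trans ih.2 (List.subset_cons_self _ _)⟩
  have hmem₀ : ∀ i, d₀ (s i) ∈ (s (i + 1)).1.1 := fun i => List.mem_cons_self
  have hmem₁ : ∀ i, d₁ (s i) ∈ (s (i + 1)).1.2 := fun i => List.mem_cons_self
  refine ⟨fun i => d₀ (s i), fun i => d₁ (s i), fun i => S (s i), fun i j hij => ?_, ?_,
    fun i k => hsub _ (hmem _ _ (Or.inl (hmem₀ i)) k),
    fun i k => hsub _ (hmem _ _ (Or.inr (hmem₁ i)) k), fun i => ?_, fun i j hij => ?_,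
    fun i => htype (s i)⟩
  · refine Substructure.closure_mono (Set.biUnion_subset_biUnion_left fun e he => ?_)
    exact he.imp (fun h => (hmono i j hij).1 h) (fun h => (hmono i j hij).2 h)
  · have : (⨆ i, S (s i)) = Substructure.closure (L.sum L.skolem₁) (⋃ i, entries (s i)) :=
      (Substructure.closure_iUnion _).symm
    rw [this]
    exact mk_skolem_closure_lt hκ (Set.countable_iUnion fun i => hcount (s i))
  -- Depth zero is exactly consistency of the branch built so far.
  · obtain ⟨b, hb⟩ := (s i).2 0
    exact ⟨b, fun j hj => hb _ ((hmono (j + 1) i hj).1 (hmem₀ j))⟩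
  · exact hinc (s j) _ (List.mem_cons_of_mem _ ((hmono (i + 1) j hij).2 (hmem₁ i)))

end Main

end SOPOne

/-! ### Limits along an ultrafilter and the main theorem. -/

open SOPOne in
theorem mainTheorem6 {L : FirstOrder.Language.{u, v}} (T : L.Theory) (hT : T.IsComplete)
    (𝕄 : Type w) [L.Structure 𝕄] [Nonempty 𝕄] (hmodel : 𝕄 ⊨ T)
    (κ : Cardinal.{w})
    (hκ : Cardinal.lift.{w} (max Cardinal.aleph0 L.card) < Cardinal.lift.{max u v} κ)
    (hsat : SOPOne.IsSaturated L 𝕄 κ)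
    {m n : ℕ} (φ : L.Formula (Fin m ⊕ Fin n)) (hφ : SOPOne.ExemplifiesSOP1 𝕄 φ) :
    ∃ (M : L.ElementarySubstructure 𝕄) (c₀ c₁ : Fin n → 𝕄) (b₀ b₁ : Fin m → 𝕄),
      Cardinal.mk M < κ ∧
      SOPOne.IndU L (M : Set 𝕄) c₀ c₁ ∧
      SOPOne.IndU L (M : Set 𝕄) c₀ b₀ ∧
      SOPOne.IndU L (M : Set 𝕄) c₁ b₁ ∧
      SOPOne.SameType L (M : Set 𝕄) (Sum.elim b₀ c₀) (Sum.elim b₁ c₁) ∧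
      φ.Realize (Sum.elim b₀ c₀) ∧
      φ.Realize (Sum.elim b₁ c₁) ∧
      ¬ SOPOne.ConsistentInstances φ {c₀, c₁} := by
  have hκ₀ := aleph0_lt_of_lift_max_lt hκ
  obtain ⟨d₀, d₁, S, hS, hcard, hd₀, hd₁, hcons, hinc, htype⟩ := hφ.exists_array hκ hsat
  have hle : ∀ i, S i ≤ ⨆ i, S i := le_iSup S
  obtain ⟨M, hM⟩ : ∃ M : L.ElementarySubstructure 𝕄, (M : Set 𝕄) = (⨆ i, S i :) :=
    ⟨(⨆ i, S i).elementarySkolem₁Reduct, rfl⟩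
  have hMmem : ∀ x : 𝕄, x ∈ (M : Set 𝕄) ↔ ∃ i, x ∈ S i := by
    intro x
    rw [hM]
    exact Substructure.mem_iSup_of_directed hS.directed_le
  have hMcard : #M < κ := by
    change #(M : Set 𝕄) < κ
    rwa [hM]
  have hMfin := fun k => mk_sum_fin_lt hκ₀.le hMcard k
  have hdM₀ : ∀ i k, d₀ i k ∈ (M : Set 𝕄) := fun i k => (hMmem _).2 ⟨_, hd₀ i k⟩
  have hdM₁ : ∀ i k, d₁ i k ∈ (M : Set 𝕄) := fun i k => (hMmem _).2 ⟨_, hd₁ i k⟩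
  let vM : ↥(M : Set 𝕄) → 𝕄 := Subtype.val
  -- `b₁` realizes all instances of `φ` at the `d₀ i`
  obtain ⟨b₁, hb₁⟩ : ∃ b : Fin m → 𝕄, ∀ i, φ.Realize (Sum.elim b (d₀ i)) := by
    let g : ℕ → Fin m ⊕ Fin n → (M : Set 𝕄) ⊕ Fin m := fun i =>
      Sum.elim Sum.inr fun k => Sum.inl ⟨d₀ i k, hdM₀ i k⟩
    have hg : ∀ i (b : Fin m → 𝕄), Sum.elim vM b ∘ g i = Sum.elim b (d₀ i) := by
      intro i b
      funext z
      rcases z with z | z <;> rfl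
    obtain ⟨b, hb⟩ := hsat.exists_realize hκ₀.le vM hMcard (fun i => φ.relabel (g i)) (by
      intro s
      obtain ⟨b, hb⟩ := hcons (s.sup id + 1)
      refine ⟨b, fun i hi => ?_⟩
      rw [Formula.realize_relabel, hg]
      exact hb i (Nat.lt_succ_of_le (Finset.le_sup (f := id) hi)))
    refine ⟨b, fun i => ?_⟩
    have := hb i
    rwa [Formula.realize_relabel, hg] at this
  let U : Ultrafilter ℕ := Filter.hyperfilter ℕ
  have hU : ∀ i, ∀ᶠ j in (U : Filter ℕ), i < j := fun i =>
    Nat.hyperfilter_le_atTop (Filter.eventually_gt_atTop i)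
  obtain ⟨c₁, hc₁⟩ := hsat.exists_realize_of_eventually hκ₀.le (Sum.elim vM b₁) (hMfin m) U d₀
  obtain ⟨c₀, hc₀⟩ := hsat.exists_realize_of_eventually hκ₀.le (Sum.elim vM c₁) (hMfin n) U d₁
  -- restricting types to `M`
  have hrestr : ∀ {k l : ℕ} (b : Fin k → 𝕄) (c : Fin l → 𝕄),
      Sum.elim (Sum.elim vM b) c ∘ Sum.map Sum.inl id = Sum.elim vM c := by
    intro k l b c
    funext z
    rcases z with z | z <;> rfl
  have hc₁M : ∀ ψ : L.Formula ((M : Set 𝕄) ⊕ Fin n),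
      ψ.Realize (Sum.elim vM c₁) ↔ ∀ᶠ i in U, ψ.Realize (Sum.elim vM (d₀ i)) := by
    intro ψ
    have := hc₁ (ψ.relabel (Sum.map Sum.inl id))
    simpa only [Formula.realize_relabel, hrestr] using this
  have hc₀M : ∀ ψ : L.Formula ((M : Set 𝕄) ⊕ Fin n),
      ψ.Realize (Sum.elim vM c₀) ↔ ∀ᶠ i in U, ψ.Realize (Sum.elim vM (d₁ i)) := by
    intro ψ
    have := hc₀ (ψ.relabel (Sum.map Sum.inl id))
    simpa only [Formula.realize_relabel, hrestr] using this
  have hc : ∀ ψ : L.Formula ((M : Set 𝕄) ⊕ Fin n),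
      ψ.Realize (Sum.elim vM c₀) ↔ ψ.Realize (Sum.elim vM c₁) := by
    intro ψ
    rw [hc₀M, hc₁M]
    refine Filter.eventually_congr ?_
    -- From `i₀` on, the parameters of `ψ` lie in `S i`, over which `d₀ i` and `d₁ i` have the same
    -- type.
    obtain ⟨i₀, h₀⟩ := exists_formula_over_of_iUnion (S := fun i => (S i : Set 𝕄)) hS
      (fun x hx => (hMmem x).1 hx) ψ
    filter_upwards [hU i₀] with i hi
    obtain ⟨ψ', hψ'⟩ := h₀ i hi.le
    rw [← hψ', ← hψ']
    exact (htype i ψ').symm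
  have hcoheir₁ : ∀ ψ : L.Formula (((M : Set 𝕄) ⊕ Fin m) ⊕ Fin n),
      ψ.Realize (Sum.elim (Sum.elim vM b₁) c₁) →
      ∃ d : Fin n → 𝕄, (∀ i, d i ∈ (M : Set 𝕄)) ∧ ψ.Realize (Sum.elim (Sum.elim vM b₁) d) := by
    intro ψ hψ
    obtain ⟨i, hi⟩ := ((hc₁ ψ).1 hψ).exists
    exact ⟨d₀ i, hdM₀ i, hi⟩
  -- transfer of `b₁` along `c₀ ≡ c₁`
  obtain ⟨b₀, hb₀⟩ : ∃ b₀ : Fin m → 𝕄, ∀ ψ : L.Formula (((M : Set 𝕄) ⊕ Fin m) ⊕ Fin n),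
      ψ.Realize (Sum.elim (Sum.elim vM b₀) c₀) ↔ ψ.Realize (Sum.elim (Sum.elim vM b₁) c₁) :=
    hsat.exists_realize_of_forall_iff hκ₀.le vM hMcard b₁ hc
  have hφ₁ : φ.Realize (Sum.elim b₁ c₁) := by
    have hg : ∀ c : Fin n → 𝕄,
        Sum.elim (Sum.elim vM b₁) c ∘ Sum.map Sum.inr id = Sum.elim b₁ c := by
      intro c
      funext z
      rcases z with z | z <;> rfl
    have := hc₁ (φ.relabel (Sum.map Sum.inr id))
    simp only [Formula.realize_relabel, hg] at this
    exact this.2 (Filter.Eventually.of_forall hb₁)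
  have hφ₀ : φ.Realize (Sum.elim b₀ c₀) := by
    have hg : ∀ (b : Fin m → 𝕄) (c : Fin n → 𝕄),
        Sum.elim (Sum.elim vM b) c ∘ Sum.map Sum.inr id = Sum.elim b c := by
      intro b c
      funext z
      rcases z with z | z <;> rfl
    have := hb₀ (φ.relabel (Sum.map Sum.inr id))
    simp only [Formula.realize_relabel, hg] at this
    exact this.2 hφ₁
  refine ⟨M, c₀, c₁, b₀, b₁, hMcard, indU_of_forall_formula fun ψ hψ => ?_,
    indU_of_forall_formula fun ψ hψ => ?_, indU_of_forall_formula hcoheir₁,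
    sameType_of_forall_formula fun ψ => ?_, hφ₀, hφ₁, ?_⟩
  · obtain ⟨i, hi⟩ := ((hc₀ ψ).1 hψ).exists
    exact ⟨d₁ i, hdM₁ i, hi⟩
  -- A witness `d` found for `b₁` also works for `b₀`, as it lies in M and `b₀` ≡ `b₁` over M.
  · obtain ⟨d, hd, hd'⟩ := hcoheir₁ ψ ((hb₀ ψ).1 hψ)
    refine ⟨d, hd, ?_⟩
    have hg : ∀ (b : Fin m → 𝕄) (c : Fin n → 𝕄), Sum.elim (Sum.elim vM b) c ∘
        Sum.elim Sum.inl (fun k => Sum.inl (Sum.inl ⟨d k, hd k⟩)) =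
        Sum.elim (Sum.elim vM b) d := by
      intro b c
      funext z
      rcases z with z | z <;> rfl
    have := hb₀ (ψ.relabel (Sum.elim Sum.inl (fun k => Sum.inl (Sum.inl ⟨d k, hd k⟩))))
    simp only [Formula.realize_relabel, hg] at this
    exact this.2 hd'
  · have hg : ∀ (b : Fin m → 𝕄) (c : Fin n → 𝕄), Sum.elim (Sum.elim vM b) c ∘
        (Equiv.sumAssoc _ _ _).symm = Sum.elim vM (Sum.elim b c) := by
      intro b c
      funext z
      rcases z with z | z | z <;> rfl
    have := hb₀ (ψ.relabel (Equiv.sumAssoc _ _ _).symm)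
    simpa only [Formula.realize_relabel, hg] using this
  · rw [consistentInstances_pair, not_not]
    -- Two limits: with i fixed, `d₁ i` in M is incompatible with `d₀ j` for j > i, hence with `c₁`;
    -- then i varies and `c₀` replaces `d₁ i`.
    obtain ⟨θ, hθ⟩ := exists_formula_realize_iff_incompatible (N := 𝕄) φ
      (α := (↥(M : Set 𝕄) ⊕ Fin n) ⊕ Fin n) Sum.inr (Sum.inl ∘ Sum.inr)
    refine (hθ (Sum.elim (Sum.elim vM c₁) c₀)).1 ((hc₀ θ).2 (Filter.Eventually.of_forall
      fun i => (hθ _).2 ?_))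
    obtain ⟨θ', hθ'⟩ := exists_formula_realize_iff_incompatible (N := 𝕄) φ
      (α := ↥(M : Set 𝕄) ⊕ Fin n) (fun k => Sum.inl ⟨d₁ i k, hdM₁ i k⟩) Sum.inr
    exact (hθ' (Sum.elim vM c₁)).1 ((hc₁M θ').2 ((hU i).mono
      fun j hj => (hθ' _).2 (hinc i j hj)))
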